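/- Let $\Sigma=\{0,1\}$ and let $\Sigma^*$ be the set of finite strings over $\Sigma$. For $f:\Sigma^*\to\Sigma$ let $\bar f(x)$ be the string $x$ with the symbol $f(x)$ appended, let $f^{\mathsf{CoT}\text{-}T}=\bar f\circ\cdots\circ\bar f$ ($T$ times), and let $f^{\mathsf{e2e}\text{-}T}(x)$ be the last symbol of $f^{\mathsf{CoT}\text{-}T}(x)$. For a class $\mathcal F\subseteq\Sigma^{\Sigma^*}$, the rule $\mathrm{Cons}_{\mathsf{CoT}}$ is the following specification: given strings $z_1,\dots,z_m$, with $x_i$ denoting $z_i$ without its last $T$ symbols, return $\hat f^{\mathsf{e2e}\text{-}T}$ for some $\hat f\in\mathcal F$ with $z_i=\hat f^{\mathsf{CoT}\text{-}T}(x_i)$ for all $i$ (with arbitrary output if there is no such $\hat f$). There is a universal constant $C>0$ such that for every $\mathcal F\subseteq\{0,1\}^{\{0,1\}^*}$ with $\mathrm{VCdim}(\mathcal F)<\infty$ and every integer $T\ge 1$ there is a function $m:\mathbb R^2\to\mathbb N$ with $$m(\varepsilon,\delta)\le \frac{C}{\varepsilon}\Big(\mathrm{VCdim}(\mathcal F)\,\max\{1,\log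 T\}\,\max\{1,\log(1/\varepsilon)\}+\log(1/\delta)\Big)\qquad\text{for all } \varepsilon,\delta\in(0,1),$$ such that the following holds. The rule $\mathrm{Cons}_{\mathsf{CoT}}$ has an implementation, and for every implementation $A$ of $\mathrm{Cons}_{\mathsf{CoT}}$, every probability distribution $\mathcal D$ on $\Sigma^*$, every $f_*\in\mathcal F$, all $\varepsilon,\delta\in(0,1)$ and every $m'\ge m(\varepsilon,\delta)$, with probability at least $1-\delta$ over i.i.d. $x_1,\dots,x_{m'}\sim\mathcal D$, with $z_i=f_*^{\mathsf{CoT}\text{-}T}(x_i)$, $$\Pr_{x\sim\mathcal D}\big(A(z_1,\dots,z_{m'})(x)\ne f_*^{\mathsf{e2e}\text{-}T}(x)\big)\le\varepsilon .$$ -/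

import Mathlib

namespace CoTLearning

open MeasureTheory

/-- Strings over the alphabet `Σ = {0,1}`. -/
abbrev Str : Type := List Bool

/-- Next-token generators `f : Σ* → Σ`. -/
abbrev Generator : Type := Str → Bool

/-- The set of strings is countable; all of its subsets are events. -/
instance instMeasurableSpaceStr : MeasurableSpace Str := ⊤

/-- The apply-and-append map `x ↦ append(x, f(x))`. -/
def applyAppend (f : Generator) (x : Str) : Str := x ++ [f x]

/-- The `T`-step chain of thought: apply-and-append iterated `T` times. -/
def CoT (f : Generator) (T : ℕ) (x : Str) : Str := (applyAppend f)^[T] x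

/-- The end-to-end map: the last token of the `T`-step chain of thought. (The default value
`false` is only used for the empty string, which does not occur when `T ≥ 1`.) -/
def e2e (f : Generator) (T : ℕ) (x : Str) : Bool := (CoT f T x).getLastD false

/-- The class `H` of binary functions realizes every labelling of the finite set `S`. -/
def Shatters {X : Type*} (H : Set (X → Bool)) (S : Finset X) : Prop :=
  ∀ y : X → Bool, ∃ h ∈ H, ∀ x ∈ S, h x = y x

/-- The Vapnik-Chervonenkis dimension: the supremum of the sizes of shattered finite sets. -/
noncomputable def VCdim {X : Type*} (H : Set (X → Bool)) : ℕ∞ :=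
  ⨆ (S : Finset X) (_ : Shatters H S), (S.card : ℕ∞)

/-- A learning rule on chain-of-thought data: it maps a finite sequence of strings
`z₁, …, zₘ` (each an input followed by its `T` generated tokens) to a predictor. -/
abbrev CoTRule : Type := List Str → (Str → Bool)

/-- `f` reproduces each `z` in `S` from the input obtained by removing its last `T` tokens. -/
def CoTConsistent (f : Generator) (T : ℕ) (S : List Str) : Prop :=
  ∀ z ∈ S, z = CoT f T (z.rdrop T)

/-- `A` is an implementation of the rule `Cons_CoT` for the base class `F`: on every sequence
with which some member of `F` is consistent, it returns the end-to-end map of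
some consistent member of `F`. -/
def IsConsCoT (F : Set Generator) (T : ℕ) (A : CoTRule) : Prop :=
  ∀ S : List Str, (∃ f ∈ F, CoTConsistent f T S) →
    ∃ f ∈ F, CoTConsistent f T S ∧ A S = e2e f T

/-- The population 0-1 error of the predictor `h` against the end-to-end map of `fstar`. -/
noncomputable def popError (D : Measure Str) (fstar : Generator) (T : ℕ) (h : Str → Bool) : ℝ :=
  D.real {x | h x ≠ e2e fstar T x}

/-- The chain-of-thought training sequence of the inputs `x₁, …, xₘ`. -/
def cotSample (fstar : Generator) (T : ℕ) {m : ℕ} (x : Fin m → Str) : List Str :=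
  List.ofFn fun i => CoT fstar T (x i)

/-- The rule `A` learns the end-to-end class of `F` from chain-of-thought data with sample
complexity `m(ε, δ)`, in the realizable setting. -/
def CoTLearnsWith (F : Set Generator) (T : ℕ) (A : CoTRule) (m : ℝ → ℝ → ℕ) : Prop :=
  ∀ (D : Measure Str) [IsProbabilityMeasure D], ∀ fstar ∈ F,
    ∀ ε δ : ℝ, 0 < ε → ε < 1 → 0 < δ → δ < 1 →
      1 - δ ≤ (Measure.pi fun _ : Fin (m ε δ) => D).real
        {x | popError D fstar T (A (cotSample fstar T x)) ≤ ε}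

end CoTLearning

/-! A consistent `f` reproduces the whole chain of `fstar` on every sample point, and its end-to-end
error lies inside the set where the two chains differ. So it suffices that the sample hits every
such set of measure above `ε`: an `ε`-net statement (`measure_missed_le`) for `cotErrorSets`.

Its growth function is small because `f` and `fstar` have the same chain at `x` iff they agree on
the `T` prefixes that `fstar` generates (`CoT_eq_CoT_iff`). These do not depend on `f`, so traces on
`n` points are determined by traces of `F` on at most `n * T` strings, and Sauer-Shelah gives `(e n
T / d) ^ d`. Thus `T` enters only through its logarithm. Double sampling with random swaps bounds
the failure probability by `2 (2 e m T / d) ^ d / 2 ^ k` with `k` about `ε m / 4`;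
`growth_div_two_pow_le` shows that this is at most `δ`. -/

namespace CoTLearning

open MeasureTheory

/-! ### VC dimension and growth function -/

section Traces

variable {X : Type*}

open Classical in
/-- The traces on the finite set `S` of the members of a family of sets. -/
noncomputable def traces (L : Set (Set X)) (S : Finset X) : Finset (Finset X) :=
  S.powerset.filter fun t => ∃ B ∈ L, ∀ x ∈ S, x ∈ t ↔ x ∈ B

/-- The family of sets whose indicators are the members of a class of binary functions. -/
def supports (H : Set (X → Bool)) : Set (Set X) := (fun h => {x | h x = true}) '' H

theorem shatters_card_le {H : Set (X → Bool)} {d : ℕ} (hd : VCdim H ≤ d) {S : Finset X}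
    (hS : Shatters H S) : S.card ≤ d := by
  have h : (S.card : ℕ∞) ≤ VCdim H := le_iSup₂_of_le S hS le_rfl
  exact_mod_cast h.trans hd

theorem shatters_of_traces_shatters [DecidableEq X] {H : Set (X → Bool)} {S s : Finset X}
    (h : (traces (supports H) S).Shatters s) : s ⊆ S ∧ Shatters H s := by
  classical
  have hsub : s ⊆ S := by
    obtain ⟨u, hu, hsu⟩ := h.exists_superset
    exact hsu.trans (Finset.mem_powerset.1 (Finset.mem_filter.1 hu).1)
  refine ⟨hsub, fun y => ?_⟩
  obtain ⟨u, hu, hsu⟩ := h (Finset.filter_subset (fun x => y x = true) s)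
  obtain ⟨-, B, ⟨f, hf, rfl⟩, hB⟩ := Finset.mem_filter.1 hu
  refine ⟨f, hf, fun x hx => ?_⟩
  have h1 := hB x (hsub hx)
  have h2 : x ∈ s ∩ u ↔ x ∈ s.filter (fun x => y x = true) := by rw [hsu]
  simp only [Finset.mem_inter, Finset.mem_filter, hx, true_and, Set.mem_ofPred_eq] at h1 h2
  rw [Bool.eq_iff_iff]
  tauto

/-- The Sauer-Shelah lemma. -/
theorem card_traces_supports_le {H : Set (X → Bool)} {d : ℕ} (hd : VCdim H ≤ d) (S : Finset X) :
    (traces (supports H) S).card ≤ ∑ i ∈ Finset.range (d + 1), S.card.choose i := by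
  classical
  refine (Finset.card_le_card_shatterer _).trans ?_
  have hsub : (traces (supports H) S).shatterer ⊆
      (Finset.range (d + 1)).biUnion fun i => S.powersetCard i := by
    intro s hs
    obtain ⟨h1, h2⟩ := shatters_of_traces_shatters (Finset.mem_shatterer.1 hs)
    have := shatters_card_le hd h2
    simp only [Finset.mem_biUnion, Finset.mem_range, Finset.mem_powersetCard]
    exact ⟨s.card, by omega, h1, rfl⟩
  refine ((Finset.card_le_card hsub).trans Finset.card_biUnion_le).trans ?_
  simp

end Traces

/-- The usual bound `(e n / d) ^ d` on the Sauer-Shelah sum. -/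
theorem sum_choose_le_pow {n d : ℕ} (hd : 0 < d) (hdn : d ≤ n) :
    (∑ i ∈ Finset.range (d + 1), (n.choose i : ℝ)) ≤ (Real.exp 1 * n / d) ^ d := by
  have hd' : (0 : ℝ) < d := by exact_mod_cast hd
  have hn' : (0 : ℝ) < n := by exact_mod_cast hd.trans_le hdn
  -- As `r ≤ 1`, weighting by `r ^ d` instead of `r ^ i` only lowers the terms; the binomial theorem
  -- then gives `(1 + r) ^ n ≤ e ^ d`.
  set r : ℝ := d / n with hr
  have hr0 : 0 < r := by positivity
  have hr1 : r ≤ 1 := by rw [hr, div_le_one hn']; exact_mod_cast hdn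
  have h1 : (∑ i ∈ Finset.range (d + 1), (n.choose i : ℝ)) * r ^ d ≤ Real.exp 1 ^ d := by
    calc (∑ i ∈ Finset.range (d + 1), (n.choose i : ℝ)) * r ^ d
        = ∑ i ∈ Finset.range (d + 1), r ^ d * n.choose i := by
          rw [Finset.sum_mul]; exact Finset.sum_congr rfl fun i _ => mul_comm _ _
      _ ≤ ∑ i ∈ Finset.range (d + 1), r ^ i * n.choose i := by
          refine Finset.sum_le_sum fun i hi => ?_
          have : i ≤ d := by simpa [Nat.lt_succ_iff] using hi
          have := pow_le_pow_of_le_one hr0.le hr1 this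
          gcongr
      _ ≤ ∑ i ∈ Finset.range (n + 1), r ^ i * n.choose i := by
          refine Finset.sum_le_sum_of_subset_of_nonneg ?_ fun i _ _ => by positivity
          exact Finset.range_subset_range.2 (by omega)
      _ = (r + 1) ^ n := by rw [add_pow]; simp
      _ ≤ Real.exp r ^ n := by gcongr; exact Real.add_one_le_exp r
      _ = Real.exp 1 ^ d := by
          rw [← Real.exp_nat_mul, ← Real.exp_nat_mul, hr]; congr 1; field_simp
  have h2 : (Real.exp 1 * n / d) ^ d = Real.exp 1 ^ d / r ^ d := by
    rw [← div_pow, hr]; congr 1; field_simp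
  rw [h2, le_div_iff₀ (by positivity)]
  exact h1

/-! ### Chains of thought and their error sets -/

section ChainOfThought

theorem CoT_succ (f : Generator) (T : ℕ) (x : Str) :
    CoT f (T + 1) x = CoT f T x ++ [f (CoT f T x)] := by
  simp [CoT, Function.iterate_succ_apply', applyAppend]

theorem CoT_zero (f : Generator) (x : Str) : CoT f 0 x = x := rfl

theorem exists_CoT_eq_append (f : Generator) (T : ℕ) (x : Str) :
    ∃ y : Str, y.length = T ∧ CoT f T x = x ++ y := by
  induction T with
  | zero => exact ⟨[], rfl, by simp [CoT_zero]⟩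
  | succ T ih =>
    obtain ⟨y, hy, h⟩ := ih
    exact ⟨y ++ [f (CoT f T x)], by simp [hy], by rw [CoT_succ, ← List.append_assoc, ← h]⟩

theorem rdrop_CoT (f : Generator) (T : ℕ) (x : Str) : (CoT f T x).rdrop T = x := by
  obtain ⟨y, hy, h⟩ := exists_CoT_eq_append f T x
  rw [h, ← hy, List.rdrop_append_length]

/-- Tokens are only appended, so equal chains have equal prefixes; hence `f` need only be tested on
the prefixes of `g`. -/
theorem CoT_eq_CoT_iff (f g : Generator) (T : ℕ) (x : Str) :
    CoT f T x = CoT g T x ↔ ∀ t < T, f (CoT g t x) = g (CoT g t x) := by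
  induction T with
  | zero => simp [CoT_zero]
  | succ T ih =>
    rw [CoT_succ, CoT_succ]
    constructor
    · intro h
      obtain ⟨h1, h2⟩ := List.append_inj' h rfl
      intro t ht
      rcases Nat.lt_succ_iff_lt_or_eq.1 ht with ht | rfl
      · exact ih.1 h1 t ht
      · rw [h1] at h2; simpa using h2
    · intro h
      have h1 := ih.2 fun t ht => h t (by omega)
      rw [h1, h T (by omega)]

theorem cotConsistent_cotSample_iff (f fstar : Generator) (T : ℕ) {m : ℕ} (x : Fin m → Str) :
    CoTConsistent f T (cotSample fstar T x) ↔ ∀ i, CoT f T (x i) = CoT fstar T (x i) := by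
  simp only [CoTConsistent, cotSample, List.mem_ofFn, forall_exists_index,
    forall_apply_eq_imp_iff, rdrop_CoT]
  exact forall_congr' fun i => eq_comm

/-- The sets of inputs on which the chain of thought of a member of `F` differs from that
of `fstar`. -/
def cotErrorSets (F : Set Generator) (fstar : Generator) (T : ℕ) : Set (Set Str) :=
  (fun f => {x | CoT f T x ≠ CoT fstar T x}) '' F

/-- Whether a chain of thought agrees with that of `fstar` depends only on the values at the
prefixes produced by `fstar`, so the traces are controlled by the growth function of `F`. -/
theorem card_traces_cotErrorSets_le {F : Set Generator} {d : ℕ} (hd : VCdim F ≤ d)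
    (fstar : Generator) (T : ℕ) {n : ℕ} {S : Finset Str} (hS : S.card ≤ n) :
    (traces (cotErrorSets F fstar T) S).card ≤
      ∑ i ∈ Finset.range (d + 1), (n * T).choose i := by
  classical
  set P : Finset Str := (S ×ˢ Finset.range T).image fun p => CoT fstar p.2 p.1 with hP
  have hPmem : ∀ x ∈ S, ∀ t < T, CoT fstar t x ∈ P := fun x hx t ht =>
    Finset.mem_image.2 ⟨(x, t), by simp [hx, ht], rfl⟩
  have hPcard : P.card ≤ n * T := by
    refine Finset.card_image_le.trans ?_
    rw [Finset.card_product, Finset.card_range]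
    gcongr
  -- Recovers the error trace of `f` on `S` from the trace of `f` on `P`.
  let g : Finset Str → Finset Str := fun t' =>
    S.filter fun x => ∃ t < T, ¬ (CoT fstar t x ∈ t' ↔ fstar (CoT fstar t x) = true)
  have hsub : traces (cotErrorSets F fstar T) S ⊆ (traces (supports F) P).image g := by
    intro s hs
    obtain ⟨hsS, B, ⟨f, hf, rfl⟩, hB⟩ := Finset.mem_filter.1 hs
    rw [Finset.mem_powerset] at hsS
    refine Finset.mem_image.2 ⟨P.filter fun y => f y = true, ?_, ?_⟩
    · refine Finset.mem_filter.2 ⟨by simp, _, ⟨f, hf, rfl⟩, fun y hy => by simp [hy]⟩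
    · ext x
      by_cases hx : x ∈ S
      · have h1 := hB x hx
        simp only [Set.mem_ofPred_eq, ne_eq, CoT_eq_CoT_iff, not_forall] at h1
        rw [h1]
        simp only [g, Finset.mem_filter, hx, true_and, exists_prop]
        refine exists_congr fun t => and_congr_right fun ht => ?_
        simp only [hPmem x hx t ht, true_and]
        exact not_congr Bool.eq_iff_iff.symm
      · simp only [g, Finset.mem_filter, hx, false_and, false_iff]
        exact fun h => hx (hsS h)
  refine (Finset.card_le_card hsub).trans (Finset.card_image_le.trans ?_)
  refine (card_traces_supports_le hd P).trans (Finset.sum_le_sum fun i _ => ?_)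
  exact Nat.choose_le_choose i hPcard

end ChainOfThought

/-! ### Double sampling and the `ε`-net theorem -/

section GhostSample

variable {X : Type*} {m : ℕ}

/-- Exchange the two components of the pairs selected by `σ`. -/
def swapPairs (σ : Fin m → Bool) (y : Fin m → X × X) : Fin m → X × X :=
  fun i => if σ i then (y i).swap else y i

/-- The double samples for which some member of `L` misses all first components and contains at
least `k` second components. -/
def ghostEvent (L : Set (Set X)) (m k : ℕ) : Set (Fin m → X × X) :=
  {y | ∃ B ∈ L, (∀ i, (y i).1 ∉ B) ∧ k ≤ {i | (y i).2 ∈ B}.ncard}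

-- Fix one good `σ₀`. Another good `σ` cannot differ from it at an index whose second component is
-- in `t`, since that would move a point of `t` to the first half. At least `k` bits are therefore
-- forced.
open Classical in
theorem two_pow_mul_card_swaps_le (y : Fin m → X × X) (k : ℕ) (t : Set X) :
    2 ^ k * (Finset.univ.filter fun σ : Fin m → Bool =>
      (∀ i, (swapPairs σ y i).1 ∉ t) ∧ k ≤ {i | (swapPairs σ y i).2 ∈ t}.ncard).card ≤ 2 ^ m := by
  set Q := Finset.univ.filter fun σ : Fin m → Bool =>
      (∀ i, (swapPairs σ y i).1 ∉ t) ∧ k ≤ {i | (swapPairs σ y i).2 ∈ t}.ncard with hQ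
  rcases Q.eq_empty_or_nonempty with h | ⟨σ₀, hσ₀⟩
  · simp [h]
  have h₀ := (Finset.mem_filter.1 hσ₀).2
  set K : Finset (Fin m) := Finset.univ.filter fun i => (swapPairs σ₀ y i).2 ∈ t with hK
  have hkK : k ≤ K.card := by
    have : {i | (swapPairs σ₀ y i).2 ∈ t} = (K : Set (Fin m)) := by ext; simp [hK]
    rw [← Set.ncard_coe_finset, ← this]
    exact h₀.2
  have hagree : ∀ σ ∈ Q, ∀ i ∈ K, σ i = σ₀ i := by
    intro σ hσ i hi
    by_contra hne
    refine (Finset.mem_filter.1 hσ).2.1 i ?_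
    have hi := (Finset.mem_filter.1 hi).2
    unfold swapPairs at hi ⊢
    cases h1 : σ i <;> cases h2 : σ₀ i <;> simp_all
  have hcard : Q.card ≤ (Finset.univ : Finset ({i // i ∉ K} → Bool)).card := by
    refine Finset.card_le_card_of_injOn (fun σ i => σ i) (fun _ _ => by simp) ?_
    intro σ hσ τ hτ h
    ext1 i
    by_cases hi : i ∈ K
    · rw [hagree σ hσ i hi, hagree τ hτ i hi]
    · exact congrFun h ⟨i, hi⟩
  have hcount : (Finset.univ : Finset ({i // i ∉ K} → Bool)).card = 2 ^ (m - K.card) := by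
    rw [Finset.card_univ, Fintype.card_fun, Fintype.card_bool, Fintype.card_subtype_compl]
    simp
  have hKm : K.card ≤ m := by simpa using K.card_le_univ
  calc 2 ^ k * Q.card ≤ 2 ^ K.card * 2 ^ (m - K.card) := by
        rw [← hcount]; exact Nat.mul_le_mul (Nat.pow_le_pow_right (by norm_num) hkK) hcard
    _ = 2 ^ m := by rw [← pow_add]; congr 1; omega

-- Swaps permute the same at most `2 * m` points, so only the trace of `B` on them matters: a union
-- bound over traces.
open Classical in
theorem two_pow_mul_card_swaps_ghostEvent_le (L : Set (Set X)) (k N : ℕ)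
    (hN : ∀ S : Finset X, S.card ≤ 2 * m → (traces L S).card ≤ N) (y : Fin m → X × X) :
    2 ^ k * (Finset.univ.filter fun σ : Fin m → Bool => swapPairs σ y ∈ ghostEvent L m k).card
      ≤ N * 2 ^ m := by
  set S : Finset X := Finset.univ.image (fun i => (y i).1) ∪ Finset.univ.image (fun i => (y i).2)
    with hS
  have hScard : S.card ≤ 2 * m := by
    refine (Finset.card_union_le _ _).trans ?_
    have h1 := Finset.card_image_le (s := Finset.univ) (f := fun i => (y i).1)
    have h2 := Finset.card_image_le (s := Finset.univ) (f := fun i => (y i).2)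
    simp only [Finset.card_univ, Fintype.card_fin] at h1 h2
    omega
  have hmem : ∀ σ i, (swapPairs σ y i).1 ∈ S ∧ (swapPairs σ y i).2 ∈ S := by
    intro σ i
    have h1 : (y i).1 ∈ S :=
      Finset.mem_union_left _ (Finset.mem_image_of_mem _ (Finset.mem_univ i))
    have h2 : (y i).2 ∈ S :=
      Finset.mem_union_right _ (Finset.mem_image_of_mem (fun i => (y i).2) (Finset.mem_univ i))
    unfold swapPairs
    split <;> simp [h1, h2]
  have hsub : (Finset.univ.filter fun σ : Fin m → Bool => swapPairs σ y ∈ ghostEvent L m k) ⊆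
      (traces L S).biUnion fun t => Finset.univ.filter fun σ : Fin m → Bool =>
        (∀ i, (swapPairs σ y i).1 ∉ (t : Set X)) ∧
          k ≤ {i | (swapPairs σ y i).2 ∈ (t : Set X)}.ncard := by
    intro σ hσ
    obtain ⟨B, hB, h1, h2⟩ := (Finset.mem_filter.1 hσ).2
    refine Finset.mem_biUnion.2 ⟨S.filter fun x => x ∈ B, ?_, ?_⟩
    · exact Finset.mem_filter.2 ⟨by simp, B, hB, fun x hx => by simp [hx]⟩
    · refine Finset.mem_filter.2 ⟨Finset.mem_univ _, fun i => ?_, ?_⟩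
      · simp [h1 i]
      · simpa [(hmem σ _).2] using h2
  calc _ ≤ 2 ^ k * ∑ t ∈ traces L S, _ :=
        Nat.mul_le_mul le_rfl ((Finset.card_le_card hsub).trans Finset.card_biUnion_le)
    _ ≤ ∑ t ∈ traces L S, 2 ^ m := by
        rw [Finset.mul_sum]
        exact Finset.sum_le_sum fun t _ =>
          (Nat.le_of_eq (by congr!)).trans (two_pow_mul_card_swaps_le y k (t : Set X))
    _ ≤ N * 2 ^ m := by
        rw [Finset.sum_const, smul_eq_mul]
        exact Nat.mul_le_mul (hN S hScard) le_rfl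

variable [MeasurableSpace X] (D : Measure X) [IsProbabilityMeasure D]

theorem measurePreserving_swapPairs (σ : Fin m → Bool) :
    MeasurePreserving (swapPairs (X := X) σ) (Measure.pi fun _ => D.prod D)
      (Measure.pi fun _ => D.prod D) := by
  refine measurePreserving_pi (fun _ : Fin m => D.prod D) (fun _ => D.prod D)
    (f := fun i p => if σ i then p.swap else p) fun i => ?_
  cases σ i
  · exact MeasurePreserving.id _
  · simpa using Measure.measurePreserving_swap

variable [Countable X] [MeasurableSingletonClass X]

/-- Symmetrization: averaging over all swaps bounds the probability of the ghost event. -/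
theorem two_pow_mul_measure_ghostEvent_le (L : Set (Set X)) (k N : ℕ)
    (hN : ∀ S : Finset X, S.card ≤ 2 * m → (traces L S).card ≤ N) :
    2 ^ k * (Measure.pi fun _ : Fin m => D.prod D) (ghostEvent L m k) ≤ N := by
  classical
  set μ := Measure.pi fun _ : Fin m => D.prod D
  set E := ghostEvent L m k
  have hE : ∀ σ : Fin m → Bool, μ E = ∫⁻ y, (swapPairs σ ⁻¹' E).indicator 1 y ∂μ := by
    intro σ
    rw [lintegral_indicator_one MeasurableSet.of_discrete]
    exact ((measurePreserving_swapPairs D σ).measure_preimage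
      MeasurableSet.of_discrete.nullMeasurableSet).symm
  have hsum : (2 : ENNReal) ^ m * μ E =
      ∫⁻ y, ∑ σ : Fin m → Bool, (swapPairs σ ⁻¹' E).indicator 1 y ∂μ := by
    rw [lintegral_finsetSum _ fun σ _ => Measurable.of_discrete,
      ← Finset.sum_congr rfl fun σ _ => hE σ]
    simp
  have hmain : (2 : ENNReal) ^ m * (2 ^ k * μ E) ≤ 2 ^ m * N := by
    calc (2 : ENNReal) ^ m * (2 ^ k * μ E)
        = 2 ^ k * (2 ^ m * μ E) := by ring
      _ = ∫⁻ y, 2 ^ k * ∑ σ : Fin m → Bool, (swapPairs σ ⁻¹' E).indicator 1 y ∂μ := by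
          rw [hsum, lintegral_const_mul _ Measurable.of_discrete]
      _ ≤ ∫⁻ _, 2 ^ m * N ∂μ := by
          refine lintegral_mono fun y => ?_
          have h := two_pow_mul_card_swaps_ghostEvent_le L k N hN y
          have h' : ∑ σ : Fin m → Bool, (swapPairs σ ⁻¹' E).indicator (1 : (Fin m → X × X) → ENNReal) y =
              ((Finset.univ.filter fun σ : Fin m → Bool => swapPairs σ y ∈ E).card : ENNReal) := by
            simp [Set.indicator_apply, Finset.sum_boole]
          rw [h', mul_comm ((2 : ENNReal) ^ m)]
          have h'' : ((2 ^ k * _ : ℕ) : ENNReal) ≤ ((N * 2 ^ m : ℕ) : ENNReal) := Nat.cast_le.2 h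
          rw [Nat.cast_mul, Nat.cast_mul] at h''
          simpa using h''
      _ = 2 ^ m * N := by simp
  exact (ENNReal.mul_le_mul_iff_right (by simp) (by simp)).1 hmain

/-- A sample rarely has far fewer points in `B` than expected. -/
theorem half_le_measure_card_ge {B : Set X} {ε : ℝ} (hB : ε < D.real B) {k : ℕ}
    (hk : (k : ℝ) < ε * m / 4 + 1) (hm : 4 ≤ ε * m) :
    1 / 2 ≤ (Measure.pi fun _ : Fin m => D) {x | k ≤ {i | x i ∈ B}.ncard} := by
  classical
  set μ := Measure.pi fun _ : Fin m => D
  -- Chernoff's method: `∏ g (x i)` is `2 ^ (-count)`, with mean at most `exp (-ε m / 2)`; Markov is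
  -- applied at level `exp (-ε m / 4)`.
  set g : X → ℝ := fun x => if x ∈ B then 1 / 2 else 1 with hg
  set p := D.real B with hp
  have hg0 : ∀ x, 0 < g x := fun x => by simp only [hg]; split <;> norm_num
  have hg1 : ∀ x, g x ≤ 1 := fun x => by simp only [hg]; split <;> norm_num
  have hgint : ∫ x, g x ∂D = 1 - p / 2 := by
    have h1 : g = fun x => 1 - B.indicator (fun _ => (1 / 2 : ℝ)) x := by
      ext x; by_cases hx : x ∈ B <;> simp [hg, hx]; norm_num
    rw [h1, integral_sub (integrable_const _)
      ((integrable_const _).indicator MeasurableSet.of_discrete),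
      integral_indicator_const _ MeasurableSet.of_discrete]
    simp [hp]; ring
  have hG : ∫ x, ∏ i, g (x i) ∂μ = (1 - p / 2) ^ m := by
    rw [integral_fintype_prod_eq_pow, hgint, Fintype.card_fin]
  have hGint : Integrable (fun x : Fin m → X => ∏ i, g (x i)) μ := by
    refine Integrable.of_bound Measurable.of_discrete.aestronglyMeasurable 1 ?_
    refine Filter.Eventually.of_forall fun x => ?_
    rw [Real.norm_of_nonneg (Finset.prod_nonneg fun i _ => (hg0 _).le)]
    exact Finset.prod_le_one (fun i _ => (hg0 _).le) fun i _ => hg1 _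
  have hmarkov := mul_meas_ge_le_integral_of_nonneg (μ := μ)
    (Filter.Eventually.of_forall fun x : Fin m → X => Finset.prod_nonneg fun i _ => (hg0 (x i)).le)
    hGint (Real.exp (-(ε * m / 4)))
  rw [hG] at hmarkov
  have hp1 : p ≤ 1 := measureReal_le_one
  have hub : (1 - p / 2) ^ m ≤ Real.exp (-(ε * m / 2)) := by
    calc (1 - p / 2) ^ m ≤ Real.exp (-(p / 2)) ^ m := by
          gcongr
          · linarith
          · linarith [Real.add_one_le_exp (-(p / 2))]
      _ = Real.exp (-(p * m / 2)) := by rw [← Real.exp_nat_mul]; congr 1; ring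
      _ ≤ _ := by gcongr
  have hsub : {x : Fin m → X | k ≤ {i | x i ∈ B}.ncard}ᶜ ⊆
      {x | Real.exp (-(ε * m / 4)) ≤ ∏ i, g (x i)} := by
    intro x hx
    set c := {i | x i ∈ B}.ncard with hc
    have hck : c < k := by simpa using hx
    have hprod : ∏ i, g (x i) = (1 / 2) ^ c := by
      have : {i | x i ∈ B} = ((Finset.univ.filter fun i => x i ∈ B : Finset (Fin m)) : Set _) := by
        ext; simp
      rw [hc, this, Set.ncard_coe_finset]
      simp [hg, Finset.prod_ite]
    have hc1 : (c : ℝ) ≤ ε * m / 4 := by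
      have : (c : ℝ) + 1 ≤ k := by exact_mod_cast hck
      linarith
    show _ ≤ ∏ i, g (x i)
    rw [hprod]
    calc Real.exp (-(ε * m / 4)) ≤ Real.exp (-(c : ℝ)) := by gcongr
      _ = Real.exp (-1) ^ c := by rw [← Real.exp_nat_mul]; congr 1; ring
      _ ≤ (1 / 2) ^ c := by
          gcongr
          rw [Real.exp_neg, one_div]
          gcongr
          linarith [Real.add_one_le_exp (1 : ℝ)]
  have hcompl : μ.real {x : Fin m → X | k ≤ {i | x i ∈ B}.ncard}ᶜ ≤ 1 / 2 := by
    refine (measureReal_mono hsub).trans ?_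
    have h1 : μ.real {x | Real.exp (-(ε * m / 4)) ≤ ∏ i, g (x i)} ≤ Real.exp (-(ε * m / 4)) := by
      refine le_of_mul_le_mul_left (hmarkov.trans (hub.trans (le_of_eq ?_)))
        (Real.exp_pos (-(ε * m / 4)))
      rw [← Real.exp_add]; congr 1; ring
    refine h1.trans ?_
    calc Real.exp (-(ε * m / 4)) ≤ Real.exp (-1) := by gcongr; linarith
      _ ≤ 1 / 2 := by
          rw [Real.exp_neg, one_div]
          gcongr
          linarith [Real.add_one_le_exp (1 : ℝ)]
  rw [probReal_compl_eq_one_sub MeasurableSet.of_discrete] at hcompl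
  have hreal : (1 / 2 : ℝ) ≤ μ.real {x : Fin m → X | k ≤ {i | x i ∈ B}.ncard} := by linarith
  calc (1 / 2 : ENNReal) = ENNReal.ofReal (1 / 2) := by
        rw [ENNReal.ofReal_div_of_pos (by norm_num)]; simp
    _ ≤ ENNReal.ofReal (μ.real _) := ENNReal.ofReal_le_ofReal hreal
    _ = _ := ofReal_measureReal

/-- The `ε`-net theorem in terms of the growth function: with high probability, an i.i.d. sample
meets every member of `L` of measure larger than `ε`. -/
theorem measure_missed_le (L : Set (Set X)) {ε : ℝ} (k N : ℕ)
    (hk : (k : ℝ) < ε * m / 4 + 1) (hm : 4 ≤ ε * m)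
    (hN : ∀ S : Finset X, S.card ≤ 2 * m → (traces L S).card ≤ N) :
    (Measure.pi fun _ : Fin m => D).real {x | ∃ B ∈ L, ε < D.real B ∧ ∀ i, x i ∉ B} ≤
      2 * N / 2 ^ k := by
  set μ := Measure.pi fun _ : Fin m => D
  set A : Set (Fin m → X) := {x | ∃ B ∈ L, ε < D.real B ∧ ∀ i, x i ∉ B} with hA
  set E' : Set ((Fin m → X) × (Fin m → X)) :=
    {q | ∃ B ∈ L, (∀ i, q.1 i ∉ B) ∧ k ≤ {i | q.2 i ∈ B}.ncard}
  have hE : (Measure.pi fun _ : Fin m => D.prod D) (ghostEvent L m k) = (μ.prod μ) E' :=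
    (measurePreserving_arrowProdEquivProdArrow X X (Fin m) (fun _ => D) fun _ => D).measure_preimage
      (s := E') MeasurableSet.of_discrete.nullMeasurableSet
  -- Once the first half is fixed, so is a missed `B`; the independent second half hits it `k` times
  -- with probability at least `1 / 2`.
  have hlow : 1 / 2 * μ A ≤ (μ.prod μ) E' := by
    rw [Measure.prod_apply MeasurableSet.of_discrete,
      ← lintegral_indicator_const MeasurableSet.of_discrete]
    refine lintegral_mono fun x => ?_
    by_cases hx : x ∈ A
    · obtain ⟨B, hB, h1, h2⟩ := id hx
      rw [Set.indicator_of_mem hx]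
      exact (half_le_measure_card_ge D h1 hk hm).trans
        (measure_mono fun x' hx' => ⟨B, hB, h2, hx'⟩)
    · rw [Set.indicator_of_notMem hx]; exact zero_le
  have hup := two_pow_mul_measure_ghostEvent_le D L k N hN
  have hfin : 2 ^ k * (1 / 2 * μ A) ≤ N := by
    refine le_trans ?_ hup
    rw [hE]
    gcongr
  have hreal := ENNReal.toReal_mono (by simp) hfin
  simp only [ENNReal.toReal_mul, ENNReal.toReal_pow, ENNReal.toReal_ofNat, ENNReal.toReal_natCast,
    ENNReal.toReal_div, ENNReal.toReal_one] at hreal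
  rw [le_div_iff₀ (by positivity)]
  change 2 ^ k * (1 / 2 * μ.real A) ≤ N at hreal
  linarith

end GhostSample

/-! ### Consistent rules and the case of dimension zero -/

theorem exists_isConsCoT (F : Set Generator) (T : ℕ) : ∃ A : CoTRule, IsConsCoT F T A := by
  classical
  refine ⟨fun S => if h : ∃ f ∈ F, CoTConsistent f T S then e2e h.choose T else fun _ => false,
    fun S h => ⟨h.choose, h.choose_spec.1, h.choose_spec.2, ?_⟩⟩
  simp [h]

theorem subsingleton_of_VCdim_eq_zero {X : Type*} {H : Set (X → Bool)} (h : VCdim H = 0) :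
    H.Subsingleton := by
  intro f hf g hg
  by_contra hne
  obtain ⟨x, hx⟩ := Function.ne_iff.1 hne
  have hs : Shatters H {x} := by
    intro y
    by_cases hy : f x = y x
    · exact ⟨f, hf, by simpa using hy⟩
    · refine ⟨g, hg, ?_⟩
      simp only [Finset.mem_singleton, forall_eq]
      revert hx hy
      cases f x <;> cases g x <;> cases y x <;> simp
  simpa using shatters_card_le (d := 0) (by simp [h]) hs

theorem cotLearnsWith_of_subsingleton {F : Set Generator} (hF : F.Subsingleton) {T : ℕ}
    {A : CoTRule} (hA : IsConsCoT F T A) (m : ℝ → ℝ → ℕ) : CoTLearnsWith F T A m := by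
  intro D _ fstar hfstar ε δ hε _ hδ _
  have huniv : {x : Fin (m ε δ) → Str | popError D fstar T (A (cotSample fstar T x)) ≤ ε} =
      Set.univ := by
    refine Set.eq_univ_of_forall fun x => ?_
    obtain ⟨f, hf, -, hAf⟩ := hA (cotSample fstar T x)
      ⟨fstar, hfstar, (cotConsistent_cotSample_iff fstar fstar T x).2 fun _ => rfl⟩
    have : popError D fstar T (A (cotSample fstar T x)) = 0 := by
      rw [hAf, hF hf hfstar]
      simp [popError]
    exact this.trans_le hε.le
  rw [huniv, probReal_univ]
  linarith

/-- A consistent rule with error above `ε` produces a missed error set of measure above `ε`. -/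
theorem exists_missed_of_lt_popError {F : Set Generator} {T : ℕ} {A : CoTRule}
    (hA : IsConsCoT F T A) (D : Measure Str) [IsProbabilityMeasure D] {fstar : Generator}
    (hfstar : fstar ∈ F) {ε : ℝ} {m : ℕ} {x : Fin m → Str}
    (hx : ε < popError D fstar T (A (cotSample fstar T x))) :
    ∃ B ∈ cotErrorSets F fstar T, ε < D.real B ∧ ∀ i, x i ∉ B := by
  obtain ⟨f, hf, hcons, hAf⟩ := hA (cotSample fstar T x)
    ⟨fstar, hfstar, (cotConsistent_cotSample_iff fstar fstar T x).2 fun _ => rfl⟩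
  refine ⟨_, ⟨f, hf, rfl⟩, hx.trans_le ?_, fun i hi =>
    hi ((cotConsistent_cotSample_iff f fstar T x).1 hcons i)⟩
  rw [hAf, popError]
  refine measureReal_mono fun y hy h => hy ?_
  rw [e2e, e2e, h]

/-! ### Sample size arithmetic -/

section SampleSize

variable {ε δ : ℝ} {d T m : ℕ}

theorem four_le_of_sample_size (hε : 0 < ε) (hδ : 0 < δ) (hδ1 : δ < 1)
    (hd : 1 ≤ d)
    (hm : 80 * (ε⁻¹ * ((d : ℝ) * max 1 (Real.log T) * max 1 (Real.log ε⁻¹) + Real.log δ⁻¹)) ≤ m) :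
    80 * ((d : ℝ) * (max 1 (Real.log T) * max 1 (Real.log ε⁻¹)) + Real.log δ⁻¹) ≤ ε * m ∧
      80 * (d : ℝ) ≤ ε * m ∧ 4 ≤ ε * m := by
  have hd' : (1 : ℝ) ≤ d := by exact_mod_cast hd
  have hlog : 0 ≤ Real.log δ⁻¹ := Real.log_nonneg (one_le_inv₀ hδ |>.2 hδ1.le)
  have hQ : 1 ≤ max 1 (Real.log T) * max 1 (Real.log ε⁻¹) :=
    one_le_mul_of_one_le_of_one_le (le_max_left _ _) (le_max_left _ _)
  have h1 : 80 * ((d : ℝ) * (max 1 (Real.log T) * max 1 (Real.log ε⁻¹)) + Real.log δ⁻¹) ≤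
      ε * m := by
    refine le_trans (le_of_eq ?_) (mul_le_mul_of_nonneg_left hm hε.le)
    field_simp
  have h2 : (d : ℝ) ≤ d * (max 1 (Real.log T) * max 1 (Real.log ε⁻¹)) :=
    le_mul_of_one_le_right (by linarith) hQ
  exact ⟨h1, by linarith, by linarith⟩

theorem growth_div_two_pow_le (hε : 0 < ε) (hδ : 0 < δ) (hδ1 : δ < 1)
    (hd : 1 ≤ d) (hT : 1 ≤ T) {k : ℕ} (hk : ε * m / 4 ≤ k)
    (hm : 80 * (ε⁻¹ * ((d : ℝ) * max 1 (Real.log T) * max 1 (Real.log ε⁻¹) + Real.log δ⁻¹)) ≤ m) :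
    2 * (Real.exp 1 * (2 * m * T : ℕ) / d) ^ d / 2 ^ k ≤ δ := by
  obtain ⟨h80, h80d, h4⟩ := four_le_of_sample_size hε hδ hδ1 hd hm
  have hd' : (1 : ℝ) ≤ d := by exact_mod_cast hd
  have hd0 : (0 : ℝ) < d := by linarith
  have hT' : (0 : ℝ) < T := by exact_mod_cast hT
  have hm0 : (0 : ℝ) < m := by
    by_contra h
    have : ε * m ≤ 0 := mul_nonpos_of_nonneg_of_nonpos hε.le (not_lt.1 h)
    linarith
  -- Isolates `u = ε m / (16 d)`: by `log u ≤ u - 1`, the dependence on `m` costs `ε m / 16` after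
  -- multiplication by `d`, less than the available `k log 2 ≥ 0.69 ε m / 4`.
  have ha : Real.exp 1 * (2 * m * T : ℕ) / d =
      Real.exp 1 * 2 ^ 5 * (ε * m / d / 16) * T * ε⁻¹ := by
    push_cast; field_simp; norm_num
  have ha0 : 0 < Real.exp 1 * (2 * m * T : ℕ) / d := by rw [ha]; positivity
  have hloga : Real.log (Real.exp 1 * (2 * m * T : ℕ) / d) ≤
      5 * Real.log 2 + ε * m / d / 16 + Real.log T + Real.log ε⁻¹ := by
    rw [ha, Real.log_mul (by positivity) (by positivity), Real.log_mul (by positivity) hT'.ne',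
      Real.log_mul (by positivity) (by positivity), Real.log_mul (by positivity) (by positivity),
      Real.log_exp, Real.log_pow]
    have := Real.log_le_sub_one_of_pos (x := ε * m / d / 16) (by positivity)
    push_cast
    linarith
  set Q := max 1 (Real.log T) * max 1 (Real.log ε⁻¹) with hQ
  have hQ1 : 1 ≤ Q := one_le_mul_of_one_le_of_one_le (le_max_left _ _) (le_max_left _ _)
  have hQT : Real.log T ≤ Q := (le_max_right 1 _).trans
    (le_mul_of_one_le_right (by positivity) (le_max_left _ _))
  have hQε : Real.log ε⁻¹ ≤ Q := (le_max_right 1 _).trans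
    (le_mul_of_one_le_left (by positivity) (le_max_left _ _))
  have hl2 := Real.log_two_lt_d9
  have hl2' := Real.log_two_gt_d9
  have hδ' : 0 ≤ Real.log δ⁻¹ := Real.log_nonneg (one_le_inv₀ hδ |>.2 hδ1.le)
  have hdQ : (d : ℝ) ≤ d * Q := le_mul_of_one_le_right hd0.le hQ1
  have hdloga : d * Real.log (Real.exp 1 * (2 * m * T : ℕ) / d) ≤
      5 * Real.log 2 * d + ε * m / 16 + 2 * (d * Q) := by
    have h1 : d * Real.log (Real.exp 1 * (2 * m * T : ℕ) / d) ≤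
        d * (5 * Real.log 2 + ε * m / d / 16 + Q + Q) := by
      gcongr; linarith
    refine h1.trans (le_of_eq ?_)
    field_simp; ring
  rw [div_le_iff₀ (by positivity), ← Real.log_le_log_iff
      (mul_pos two_pos (pow_pos ha0 d)) (by positivity),
    Real.log_mul (by norm_num) (pow_pos ha0 d).ne', Real.log_mul (by positivity) (by positivity),
    Real.log_pow, Real.log_pow]
  rw [Real.log_inv] at h80 hδ'
  have hk2 : ε * m / 4 * 0.69 ≤ k * Real.log 2 := by
    gcongr; linarith
  have h5 : 5 * Real.log 2 * d ≤ 5 * 0.7 * d := by gcongr; linarith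
  linarith

end SampleSize

/-! ### Assembly -/

theorem cotLearnsWith_of_sample_size {F : Set Generator} {d T : ℕ} (hF : VCdim F ≤ d) (hd : 1 ≤ d)
    (hT : 1 ≤ T) {A : CoTRule} (hA : IsConsCoT F T A) {m : ℝ → ℝ → ℕ}
    (hm : ∀ ε δ : ℝ, 0 < ε → ε < 1 → 0 < δ → δ < 1 →
      80 * (ε⁻¹ * ((d : ℝ) * max 1 (Real.log T) * max 1 (Real.log ε⁻¹) + Real.log δ⁻¹)) ≤ m ε δ) :
    CoTLearnsWith F T A m := by
  intro D _ fstar hfstar ε δ hε hε1 hδ hδ1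
  have hm := hm ε δ hε hε1 hδ hδ1
  set n := m ε δ
  obtain ⟨-, h80d, h4⟩ := four_le_of_sample_size hε hδ hδ1 hd hm
  set k := ⌈ε * n / 4⌉₊ with hk
  have hk1 : (k : ℝ) < ε * n / 4 + 1 := Nat.ceil_lt_add_one (by positivity)
  have hmiss := measure_missed_le D (cotErrorSets F fstar T) k
    (∑ i ∈ Finset.range (d + 1), (2 * n * T).choose i) hk1 h4
    fun S hS => card_traces_cotErrorSets_le hF fstar T hS
  have hdn : d ≤ 2 * n * T := by
    have h1 : (d : ℝ) ≤ n := by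
      have : ε * n ≤ 1 * n := by gcongr
      have : (0 : ℝ) ≤ d := by positivity
      linarith
    have h2 : d ≤ n := by exact_mod_cast h1
    nlinarith
  have hsum := sum_choose_le_pow hd hdn
  have hδle := growth_div_two_pow_le hε hδ hδ1 hd hT (Nat.le_ceil _) hm
  have hbad : (Measure.pi fun _ : Fin n => D).real
      {x | popError D fstar T (A (cotSample fstar T x)) ≤ ε}ᶜ ≤ δ := by
    refine (measureReal_mono fun x hx => ?_).trans (hmiss.trans (le_trans ?_ hδle))
    · exact exists_missed_of_lt_popError hA D hfstar (not_le.1 hx)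
    · push_cast at hsum ⊢
      gcongr
  rw [probReal_compl_eq_one_sub MeasurableSet.of_discrete] at hbad
  linarith

end CoTLearning

theorem mainTheorem2 :
    ∃ C : ℝ, 0 < C ∧
      ∀ (F : Set CoTLearning.Generator) (d : ℕ), CoTLearning.VCdim F = d →
        ∀ T : ℕ, 1 ≤ T →
          ∃ m : ℝ → ℝ → ℕ,
            (∀ ε δ : ℝ, 0 < ε → ε < 1 → 0 < δ → δ < 1 →
              (m ε δ : ℝ) ≤ C * (ε⁻¹ *
                ((d : ℝ) * max 1 (Real.log T) * max 1 (Real.log ε⁻¹) + Real.log δ⁻¹))) ∧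
            (∃ A : CoTLearning.CoTRule, CoTLearning.IsConsCoT F T A) ∧
            ∀ A : CoTLearning.CoTRule, CoTLearning.IsConsCoT F T A →
              ∀ m' : ℝ → ℝ → ℕ, (∀ ε δ : ℝ, m ε δ ≤ m' ε δ) →
                CoTLearning.CoTLearnsWith F T A m' := by
  -- 80 suffices before rounding; one more unit absorbs the ceiling, as the bracket is at least 1
  -- when `d ≥ 1`.
  refine ⟨81, by norm_num, fun F d hF T hT => ?_⟩
  -- For `d = 0` the budget can be below 1, so no sample is affordable; none is needed, as `F` has
  -- at most one member.
  rcases Nat.eq_zero_or_pos d with rfl | hd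
  · refine ⟨fun _ _ => 0, fun ε δ hε _ hδ hδ1 => ?_, CoTLearning.exists_isConsCoT F T,
      fun A hA m' _ => CoTLearning.cotLearnsWith_of_subsingleton
        (CoTLearning.subsingleton_of_VCdim_eq_zero (by simpa using hF)) hA m'⟩
    have : 0 ≤ Real.log δ⁻¹ := Real.log_nonneg (one_le_inv₀ hδ |>.2 hδ1.le)
    simp only [Nat.cast_zero, zero_mul, zero_add]
    positivity
  · refine ⟨fun ε δ => ⌈80 * (ε⁻¹ * ((d : ℝ) * max 1 (Real.log T) * max 1 (Real.log ε⁻¹) +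
      Real.log δ⁻¹))⌉₊, fun ε δ hε hε1 hδ hδ1 => ?_, CoTLearning.exists_isConsCoT F T,
      fun A hA m' hm' => CoTLearning.cotLearnsWith_of_sample_size hF.le hd hT hA
        fun ε δ _ _ _ _ => (Nat.le_ceil _).trans (by exact_mod_cast hm' ε δ)⟩
    have hlog : 0 ≤ Real.log δ⁻¹ := Real.log_nonneg (one_le_inv₀ hδ |>.2 hδ1.le)
    have hd1 : (1 : ℝ) ≤ d := by exact_mod_cast hd
    have hprod : 1 ≤ (d : ℝ) * max 1 (Real.log T) * max 1 (Real.log ε⁻¹) :=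
      one_le_mul_of_one_le_of_one_le
        (one_le_mul_of_one_le_of_one_le hd1 (le_max_left _ _)) (le_max_left _ _)
    have hone : 1 ≤ ε⁻¹ * ((d : ℝ) * max 1 (Real.log T) * max 1 (Real.log ε⁻¹) +
        Real.log δ⁻¹) :=
      one_le_mul_of_one_le_of_one_le (one_le_inv₀ hε |>.2 hε1.le) (by linarith)
    refine (Nat.ceil_lt_add_one (by positivity)).le.trans ?_
    linarith
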